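/- Let $q$ be a prime power, $\mathbb{F}_q$ the field with $q$ elements and $t$ an indeterminate. A monic polynomial $g\in\mathbb{F}_q[x]$ of degree $d$ with $g(0)\neq 0$ is called self-reciprocal if $g(x)=g(0)^{-1}x^{d}g(x^{-1})$. Let $M\in\mathbb{F}_q[x]$ be a monic self-reciprocal polynomial of degree $2m$ of the form \[ M(x)=(x-1)^2g_1(x)\cdots g_{r-1}(x),\qquad r\ge 1, \] where $g_1,\dots,g_{r-1}$ are distinct monic irreducible polynomials in $\mathbb{F}_q[x]$, none of them equal to $x-1$ or $x+1$. Put \[ M_t(x)=M(x)+t x^m\in\mathbb{F}_q(t)[x], \] let $E$ be a splitting field of $M_t$ over $\mathbb{F}_q(t)$ and let $H=\mathrm{Gal}(E/\mathbb{F}_q(t))$ be the Galois group of $M_t$. Then for every root $\alpha$ of $M_t$ in $E$ we have $\alpha\neq\alpha^{-1}$, and $H$ contains an element that interchanges $\alpha$ and $\alpha^{-1}$ and fixes all other roots of $M_t$. Moreover, the subgroup $N$ of $H$ consisting of all elements that map each set $\{\alpha,\alpha^{-1}\}$ ($\alpha$ a root of $M_t$) to itself is a normal elementary abelian $2$-subgroup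 of $H$ of order $2^m$. -/

import Mathlib

open Polynomial
open scoped Pointwise

/-- For a polynomial `g` of degree `d` with `g(0) ≠ 0`, the polynomial
`g*(x) = x ^ d * g(0)⁻¹ * g(x⁻¹)`. Here `g.reverse` is `x ^ d * g(x⁻¹)`. -/
noncomputable def reciprocalPoly {F : Type*} [Field F] (g : F[X]) : F[X] :=
  C (g.coeff 0)⁻¹ * g.reverse

/-- A monic polynomial `g` with `g(0) ≠ 0` is self-reciprocal if `g = g*`. -/
def IsSelfReciprocal {F : Type*} [Field F] (g : F[X]) : Prop :=
  g.Monic ∧ g.coeff 0 ≠ 0 ∧ g = reciprocalPoly g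

/-- The polynomial `M_t(x) = M(x) + t x ^ m` over the rational function field `F(t)`. -/
noncomputable def deformedPoly {F : Type*} [Field F] (M : F[X]) (m : ℕ) : (RatFunc F)[X] :=
  M.map (RatFunc.C (K := F)) + C (RatFunc.X (K := F)) * X ^ m

/-- `σ` acts on the roots of `f` in `E` as the transposition interchanging the two different
elements `α` and `α⁻¹`, and fixing all other roots. -/
def IsRootTransposition {K E : Type*} [Field K] [Field E] [Algebra K E] (f : K[X]) (α : E)
    (σ : E ≃ₐ[K] E) : Prop :=
  α ≠ α⁻¹ ∧ σ α = α⁻¹ ∧ σ α⁻¹ = α ∧ ∀ β ∈ f.rootSet E, β ≠ α → β ≠ α⁻¹ → σ β = β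

/-- The kernel of the action of the Galois group on the blocks `{α, α⁻¹}`, where `α` runs over the
roots of `f` in `E`: the automorphisms that map every block to itself. -/
noncomputable def blockKernel {K : Type*} [Field K] (f : K[X]) (E : Type*) [Field E]
    [Algebra K E] : Subgroup (E ≃ₐ[K] E) :=
  ⨅ α ∈ f.rootSet E, MulAction.stabilizer (E ≃ₐ[K] E) ({α, α⁻¹} : Set E)

/-- A subgroup is an elementary abelian `2`-group if it is commutative and all its elements
satisfy `σ ^ 2 = 1`. -/
def IsElementaryAbelianTwo {G : Type*} [Group G] (N : Subgroup G) : Prop :=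
  (∀ σ ∈ N, ∀ τ ∈ N, σ * τ = τ * σ) ∧ ∀ σ ∈ N, σ ^ 2 = 1

/-! `M_t` is linear in `t`, hence irreducible, and its Galois group is transitive on the roots.
Modulo a prime `Q` over `t = 0` in the integral closure of `F[t]`, `M_t` becomes `M = (x - 1)² G`,
whose only multiple root is `1`, of multiplicity two. A root `a` with residue `1` satisfies `t = -(a
- 1)² G(a) a⁻ᵐ`, so `t ∈ Q²` and the inertia group is nontrivial. Inertia preserves residues, so it
can only move the two roots with residue `1`; these are mutually inverse, which gives one
transposition (`exists_isRootTransposition`). Conjugation yields a transposition for every pair `{α,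
α⁻¹}`. An element of the block kernel is determined by the set of pairs it swaps, and products of
transpositions realise every such set, whence the order `2 ^ m` (`card_blockKernel`). -/

section SelfReciprocal

variable {F : Type*} [Field F] {M : F[X]}

/-- Self-reciprocity forces `M(0) = ±1`. In even degree the sign `-1` would give `M(-1) = -M(-1)`.
-/
theorem IsSelfReciprocal.coeff_zero_eq_one (hM : IsSelfReciprocal M)
    (heven : Even M.natDegree) (h : (2 : F) = 0 ∨ M.eval (-1) ≠ 0) : M.coeff 0 = 1 := by
  obtain ⟨hmon, h0, hrec⟩ := hM
  rw [reciprocalPoly] at hrec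
  have h1 : M.coeff 0 = (M.coeff 0)⁻¹ := by
    conv_lhs => rw [hrec]
    rw [coeff_C_mul, coeff_zero_reverse, hmon.leadingCoeff, mul_one]
  have h2 : M.coeff 0 * M.coeff 0 = 1 := by
    nth_rewrite 2 [h1]
    exact mul_inv_cancel₀ h0
  rcases mul_self_eq_one_iff.mp h2 with h3 | h3
  · exact h3
  rcases h with h | h
  · rw [h3]
    linear_combination -h
  · refine h3.trans ?_
    let : Invertible (-1 : F) := invertibleOfNonzero (by simp)
    have h4 := eval₂_reverse_mul_pow (RingHom.id F) (-1) M
    rw [heven.neg_one_pow, mul_one, invOf_eq_inv, inv_neg, inv_one] at h4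
    have h5 : M.eval (-1) = (M.coeff 0)⁻¹ * M.reverse.eval (-1) := by
      conv_lhs => rw [hrec]
      rw [eval_mul, eval_C]
    rw [← h1, h3] at h5
    change M.reverse.eval (-1) = M.eval (-1) at h4
    rw [h4] at h5
    have h6 : (2 : F) * M.eval (-1) = 0 := by linear_combination h5
    have h7 := (mul_eq_zero.mp h6).resolve_right h
    linear_combination -h7

theorem IsSelfReciprocal.reverse_eq (hM : IsSelfReciprocal M) (h : M.coeff 0 = 1) :
    M.reverse = M := by
  have := hM.2.2
  rw [reciprocalPoly, h, inv_one, C_1, one_mul] at this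
  exact this.symm

end SelfReciprocal

/-- The polynomial `M + t x ^ m` with coefficients in `F[t]`. -/
noncomputable def integralDeformedPoly {F : Type*} [Field F] (M : F[X]) (m : ℕ) : F[X][X] :=
  M.map C + C X * X ^ m

/-! ### Irreducibility and separability of `M_t` -/

section Deformed

variable {F : Type*} [Field F] {M : F[X]} {m : ℕ}

theorem map_integralDeformedPoly (M : F[X]) (m : ℕ) :
    (integralDeformedPoly M m).map (algebraMap F[X] (RatFunc F)) = deformedPoly M m := by
  rw [integralDeformedPoly, deformedPoly, Polynomial.map_add, Polynomial.map_mul, map_map,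
    Polynomial.map_pow, map_X, map_C, RatFunc.algebraMap_X]
  congr 2

theorem degree_C_X_mul_X_pow_lt (hM : m < M.natDegree) :
    degree (C X * X ^ m : F[X][X]) < degree (M.map (C : F →+* F[X])) := by
  rw [degree_map_eq_of_injective C_injective]
  refine (degree_C_mul_X_pow_le _ _).trans_lt ?_
  rw [degree_eq_natDegree (by rintro rfl; simp at hM)]
  exact_mod_cast hM

theorem monic_integralDeformedPoly (hM : M.Monic) (hdeg : m < M.natDegree) :
    (integralDeformedPoly M m).Monic :=
  (hM.map C).add_of_left (degree_C_X_mul_X_pow_lt hdeg)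

theorem natDegree_integralDeformedPoly (hdeg : m < M.natDegree) :
    (integralDeformedPoly M m).natDegree = M.natDegree := by
  rw [integralDeformedPoly, natDegree_add_eq_left_of_degree_lt (degree_C_X_mul_X_pow_lt hdeg),
    natDegree_map_eq_of_injective C_injective]

/-- With the variables exchanged this is `x ^ m * t + M(x)`, of degree one in `t` with coprime
coefficients because `M(0) ≠ 0`. -/
theorem irreducible_integralDeformedPoly (h0 : M.coeff 0 ≠ 0) :
    Irreducible (integralDeformedPoly M m) := by
  have h : Bivariate.swap (C (X ^ m) * X + C M : F[X][X]) = integralDeformedPoly M m := by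
    rw [map_add, map_mul, Bivariate.swap_Y, Bivariate.swap_C, Bivariate.swap_C,
      integralDeformedPoly, Polynomial.map_pow, map_X]
    ring
  rw [← h, MulEquiv.irreducible_iff]
  refine irreducible_C_mul_X_add_C (pow_ne_zero _ X_ne_zero) (IsCoprime.isRelPrime ?_)
  refine IsCoprime.pow_left ((irreducible_X.coprime_iff_not_dvd).mpr ?_)
  rwa [X_dvd_iff]

theorem irreducible_deformedPoly (hM : M.Monic) (hdeg : m < M.natDegree) (h0 : M.coeff 0 ≠ 0) :
    Irreducible (deformedPoly M m) := by
  rw [← map_integralDeformedPoly]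
  exact ((monic_integralDeformedPoly hM hdeg).irreducible_iff_irreducible_map_fraction_map).mp
    (irreducible_integralDeformedPoly h0)

theorem natDegree_deformedPoly (hM : M.Monic) (hdeg : m < M.natDegree) :
    (deformedPoly M m).natDegree = M.natDegree := by
  rw [← map_integralDeformedPoly, (monic_integralDeformedPoly hM hdeg).natDegree_map,
    natDegree_integralDeformedPoly hdeg]

theorem derivative_deformedPoly_eq_zero (h : derivative (deformedPoly M m) = 0) :
    (m : F) = 0 ∧ derivative M = 0 := by
  rw [← map_integralDeformedPoly, derivative_map, Polynomial.map_eq_zero_iff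
    (RatFunc.algebraMap_injective F), integralDeformedPoly, derivative_add, derivative_map,
    derivative_C_mul, derivative_X_pow] at h
  rw [← C_eq_natCast] at h
  have hmF : (m : F) = 0 := by
    -- Coefficient of `t x ^ (m - 1)`: the coefficients of `M'` are constant in `t` and contribute
    -- nothing.
    have h1 := congrArg (fun p : F[X][X] => (p.coeff (m - 1)).coeff 1) h
    simp only [coeff_add, coeff_map, coeff_C_mul, coeff_X_pow_self, mul_one, coeff_X_mul,
      coeff_C_succ, coeff_C_zero, zero_add, coeff_zero] at h1
    simpa [coeff_C] using h1
  refine ⟨hmF, ?_⟩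
  rw [hmF, C_0, C_0, zero_mul, mul_zero, add_zero, Polynomial.map_eq_zero_iff C_injective] at h
  exact h

/-- Otherwise the derivative vanishes, so `m = 0` in `F` and `M' = 0`. The latter forces
characteristic two and `G' = 0`, so the separable `G` is constant and `m = 1`, a contradiction. -/
theorem separable_deformedPoly (hM : M.Monic) (hm : 0 < m) (hdeg : M.natDegree = 2 * m)
    (h0 : M.coeff 0 ≠ 0) {G : F[X]} (hG : G.Separable) (hG1 : G.eval 1 ≠ 0)
    (hfac : M = (X - 1) ^ 2 * G) : (deformedPoly M m).Separable := by
  refine (separable_iff_derivative_ne_zero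
    (irreducible_deformedPoly hM (by omega) h0)).mpr fun hder => ?_
  obtain ⟨hmF, hM'⟩ := derivative_deformedPoly_eq_zero hder
  have hX : (X - 1 : F[X]) ≠ 0 := X_sub_C_ne_zero 1
  have h1 : 2 * G + (X - 1) * derivative G = 0 := by
    refine (mul_eq_zero.mp (?_ : (X - 1 : F[X]) * _ = 0)).resolve_left hX
    rw [← hM', hfac]
    simp [derivative_pow, C_ofNat]
    ring
  have h2 : (2 : F) = 0 := by
    have := congrArg (eval 1) h1
    simpa [hG1] using this
  have h3 : derivative G = 0 := by
    have h2' : (2 : F[X]) = 0 := by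
      rw [← C_ofNat, h2, C_0]
    rw [h2', zero_mul, zero_add] at h1
    exact (mul_eq_zero.mp h1).resolve_left hX
  rw [Polynomial.Separable, h3, isCoprime_zero_right] at hG
  have h4 : M.natDegree = 2 := by
    rw [hfac, natDegree_mul (pow_ne_zero _ hX) hG.ne_zero, natDegree_eq_zero_of_isUnit hG,
      natDegree_pow, ← C_1, natDegree_X_sub_C]
  have : m = 1 := by omega
  rw [this] at hmF
  simp at hmF

end Deformed

/-! ### The block kernel and its order -/

section BlockKernel

variable {K E : Type*} [Field K] [Field E] [Algebra K E] {f : K[X]}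

theorem algEquiv_smul_pair (σ : E ≃ₐ[K] E) (α : E) :
    σ • ({α, α⁻¹} : Set E) = {σ α, (σ α)⁻¹} := by
  rw [← Set.image_smul, Set.image_pair, AlgEquiv.smul_def, AlgEquiv.smul_def, map_inv₀]

theorem mem_blockKernel {σ : E ≃ₐ[K] E} :
    σ ∈ blockKernel f E ↔ ∀ α ∈ f.rootSet E, σ α = α ∨ σ α = α⁻¹ := by
  simp only [blockKernel, Subgroup.mem_iInf, MulAction.mem_stabilizer_iff, algEquiv_smul_pair]
  refine forall₂_congr fun α _ => ⟨fun h => ?_, ?_⟩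
  · have : σ α ∈ ({α, α⁻¹} : Set E) := h ▸ Set.mem_insert _ _
    simpa using this
  · rintro (h | h) <;> rw [h]
    rw [inv_inv, Set.pair_comm]

theorem algEquiv_apply_mem_rootSet (σ : E ≃ₐ[K] E) {α : E} (hα : α ∈ f.rootSet E) :
    σ α ∈ f.rootSet E := by
  rw [mem_rootSet] at hα ⊢
  exact ⟨hα.1, by rw [aeval_algHom_apply, hα.2, map_zero]⟩

theorem normal_blockKernel : (blockKernel f E).Normal := by
  refine ⟨fun σ hσ ρ => ?_⟩
  rw [mem_blockKernel] at hσ ⊢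
  intro α hα
  rw [AlgEquiv.mul_apply, AlgEquiv.mul_apply]
  have hρ : ρ (ρ⁻¹ α) = α := by rw [← AlgEquiv.mul_apply, mul_inv_cancel, AlgEquiv.one_apply]
  rcases hσ _ (algEquiv_apply_mem_rootSet ρ⁻¹ hα) with h | h <;> rw [h]
  · exact .inl hρ
  · exact .inr (by rw [map_inv₀, hρ])

theorem algEquiv_ext_of_rootSet [IsSplittingField K E f] {σ τ : E ≃ₐ[K] E}
    (h : ∀ α ∈ f.rootSet E, σ α = τ α) : σ = τ := by
  have := AlgHom.ext_of_adjoin_eq_top (IsSplittingField.adjoin_rootSet E f)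
    (φ₁ := σ.toAlgHom) (φ₂ := τ.toAlgHom) h
  ext x
  exact DFunLike.congr_fun this x

theorem isElementaryAbelianTwo_blockKernel [IsSplittingField K E f] :
    IsElementaryAbelianTwo (blockKernel f E) := by
  refine ⟨fun σ hσ τ hτ => algEquiv_ext_of_rootSet (f := f) fun α hα => ?_,
    fun σ hσ => algEquiv_ext_of_rootSet (f := f) fun α hα => ?_⟩
  · rw [mem_blockKernel] at hσ hτ
    rw [AlgEquiv.mul_apply, AlgEquiv.mul_apply]
    rcases hσ α hα with h | h <;> rcases hτ α hα with h' | h' <;> simp [h, h']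
  · rw [mem_blockKernel] at hσ
    rw [pow_two, AlgEquiv.mul_apply, AlgEquiv.one_apply]
    rcases hσ α hα with h | h <;> simp [h]

theorem IsRootTransposition.mem_blockKernel {α : E} {σ : E ≃ₐ[K] E}
    (h : IsRootTransposition f α σ) : σ ∈ blockKernel f E := by
  rw [_root_.mem_blockKernel]
  intro β hβ
  by_cases h1 : β = α
  · exact .inr (h1 ▸ h.2.1)
  by_cases h2 : β = α⁻¹
  · exact .inr (by rw [h2, inv_inv, h.2.2.1])
  · exact .inl (h.2.2.2 β hβ h1 h2)

theorem IsRootTransposition.conj {α : E} {σ : E ≃ₐ[K] E}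
    (h : IsRootTransposition f α σ) (ρ : E ≃ₐ[K] E) :
    IsRootTransposition f (ρ α) (ρ * σ * ρ⁻¹) := by
  have hρ : ∀ x, ρ⁻¹ (ρ x) = x := fun x => by
    rw [← AlgEquiv.mul_apply, inv_mul_cancel, AlgEquiv.one_apply]
  have hρ' : ∀ x, ρ (ρ⁻¹ x) = x := fun x => by
    rw [← AlgEquiv.mul_apply, mul_inv_cancel, AlgEquiv.one_apply]
  obtain ⟨h1, h2, h3, h4⟩ := h
  refine ⟨fun h => h1 (ρ.injective (by rwa [map_inv₀])), ?_, ?_, fun β hβ hβ1 hβ2 => ?_⟩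
  · rw [AlgEquiv.mul_apply, AlgEquiv.mul_apply, hρ, h2, map_inv₀]
  · rw [AlgEquiv.mul_apply, AlgEquiv.mul_apply, ← map_inv₀, hρ, h3]
  · rw [AlgEquiv.mul_apply, AlgEquiv.mul_apply,
      h4 _ (algEquiv_apply_mem_rootSet ρ⁻¹ hβ), hρ']
    · exact fun h => hβ1 (by rw [← h, hρ'])
    · exact fun h => hβ2 (by rw [← map_inv₀, ← h, hρ'])

/-- A finite set that is closed under a fixed-point-free inversion is the disjoint union of a set
of representatives and its inverse. -/
theorem exists_representatives_of_inv [DecidableEq E] (S : Finset E) (hinv : ∀ a ∈ S, a⁻¹ ∈ S)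
    (hne : ∀ a ∈ S, a ≠ a⁻¹) :
    ∃ T ⊆ S, 2 * T.card = S.card ∧ (∀ a ∈ S, a ∈ T ∨ a⁻¹ ∈ T) ∧ ∀ a ∈ T, a⁻¹ ∉ T := by
  classical
  -- Any linear order will do: the smaller element of each pair is the representative.
  let : LinearOrder E := linearOrderOfSTO WellOrderingRel
  have key : S.filter (fun a => ¬ a < a⁻¹) = (S.filter fun a => a < a⁻¹).image (·⁻¹) := by
    ext a
    simp only [Finset.mem_filter, Finset.mem_image]
    constructor
    · rintro ⟨ha, h⟩
      refine ⟨a⁻¹, ⟨hinv a ha, ?_⟩, inv_inv a⟩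
      rw [inv_inv]
      exact lt_of_le_of_ne (not_lt.mp h) (hne a ha).symm
    · rintro ⟨b, ⟨hb, h⟩, rfl⟩
      exact ⟨hinv b hb, by rw [inv_inv]; exact h.le.not_gt⟩
  refine ⟨S.filter fun a => a < a⁻¹, Finset.filter_subset _ _, ?_, fun a ha => ?_,
    fun a ha ha' => ?_⟩
  · rw [← Finset.card_filter_add_card_filter_not (s := S) (fun a => a < a⁻¹), key,
      Finset.card_image_of_injective _ inv_injective]
    ring
  · simp only [Finset.mem_filter]
    rcases lt_or_gt_of_ne (hne a ha) with h | h
    · exact .inl ⟨ha, h⟩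
    · exact .inr ⟨hinv a ha, by rwa [inv_inv]⟩
  · simp only [Finset.mem_filter, inv_inv] at ha ha'
    exact lt_asymm ha.2 ha'.2

theorem card_blockKernel [IsSplittingField K E f] {m : ℕ}
    (hcard : (f.rootSet E).ncard = 2 * m) (hinv : ∀ α ∈ f.rootSet E, α⁻¹ ∈ f.rootSet E)
    (htr : ∀ α ∈ f.rootSet E, ∃ σ : E ≃ₐ[K] E, IsRootTransposition f α σ) :
    Nat.card (blockKernel f E) = 2 ^ m := by
  classical
  set S : Finset E := (rootSet_finite f E).toFinset with hS
  have memS : ∀ a, a ∈ S ↔ a ∈ f.rootSet E := fun a => Set.Finite.mem_toFinset _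
  obtain ⟨T, hTS, hTcard, hcover, hdisj⟩ := exists_representatives_of_inv S
    (fun a ha => (memS _).mpr (hinv a ((memS a).mp ha)))
    (fun a ha => (htr a ((memS a).mp ha)).choose_spec.1)
  have hTm : T.card = m := by
    rw [Set.ncard_eq_toFinset_card _ (rootSet_finite f E)] at hcard
    have : S.card = 2 * m := hcard
    omega
  have hT : ∀ {a}, a ∈ T → a ∈ f.rootSet E := fun ha => (memS _).mp (hTS ha)
  -- `T` meets each pair once, so the representatives moved record which pairs are swapped.
  let moved : blockKernel f E → T.powerset := fun σ =>
    ⟨T.filter fun a => σ.1 a ≠ a, Finset.mem_powerset.mpr (Finset.filter_subset _ _)⟩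
  have hbij : Function.Bijective moved := by
    constructor
    · rintro ⟨σ, hσ⟩ ⟨τ, hτ⟩ h
      have h' : ∀ a ∈ T, (σ a = a ↔ τ a = a) := fun a ha => by
        have := Finset.ext_iff.mp (congrArg Subtype.val h) a
        simp only [moved, Finset.mem_filter, ha, true_and, ne_eq] at this
        exact not_iff_not.mp this
      rw [mem_blockKernel] at hσ hτ
      have hTeq : ∀ a ∈ T, σ a = τ a := fun a ha => by
        by_cases hc : σ a = a
        · rw [hc, (h' a ha).mp hc]
        · rw [(hσ a (hT ha)).resolve_left hc,
            (hτ a (hT ha)).resolve_left (mt (h' a ha).mpr hc)]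
      refine Subtype.ext (algEquiv_ext_of_rootSet (f := f) fun a ha => ?_)
      rcases hcover a ((memS a).mpr ha) with h | h
      · exact hTeq a h
      · have := hTeq _ h
        rwa [map_inv₀, map_inv₀, inv_inj] at this
    · rintro ⟨U, hU⟩
      suffices H : U ⊆ T → ∃ σ ∈ blockKernel f E, ∀ a ∈ T, (σ a ≠ a ↔ a ∈ U) by
        obtain ⟨σ, hσ, h⟩ := H (Finset.mem_powerset.mp hU)
        refine ⟨⟨σ, hσ⟩, Subtype.ext ?_⟩
        ext a
        simp only [moved, Finset.mem_filter]
        exact ⟨fun ha => (h a ha.1).mp ha.2,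
          fun ha => have ha' := Finset.mem_powerset.mp hU ha; ⟨ha', (h a ha').mpr ha⟩⟩
      clear hU
      intro hU
      induction U using Finset.induction_on with
      | empty => exact ⟨1, one_mem _, fun a _ => by simp⟩
      | insert u U hu ih =>
        obtain ⟨σ, hσ, h⟩ := ih fun x hx => hU (Finset.mem_insert_of_mem hx)
        have huT : u ∈ T := hU (Finset.mem_insert_self _ _)
        obtain ⟨τ, hτ⟩ := htr u (hT huT)
        refine ⟨σ * τ, mul_mem hσ hτ.mem_blockKernel, fun a ha => ?_⟩
        rw [AlgEquiv.mul_apply, Finset.mem_insert]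
        by_cases hau : a = u
        · subst hau
          have : σ a = a := not_not.mp (mt (h a ha).mp hu)
          rw [hτ.2.1, map_inv₀, this]
          simp [hτ.1.symm]
        -- Within `T` the transposition `τ` moves only `u`, as `u⁻¹ ∉ T`.
        · have hau' : a ≠ u⁻¹ := fun h => hdisj u huT (h ▸ ha)
          rw [hτ.2.2.2 a (hT ha) hau hau']
          simp [hau, h a ha]
  rw [Nat.card_eq_of_bijective moved hbij, Nat.card_eq_fintype_card, Fintype.card_coe,
    Finset.card_powerset, hTm]

end BlockKernel

/-! ### Ramification and inertia -/

section Inertia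

/-- If `p` ramifies at `P`, there is a nontrivial automorphism acting trivially modulo `P`. -/
theorem exists_ne_one_sub_mem_of_map_le_sq {A B K L : Type*} [CommRing A] [IsDedekindDomain A]
    [CommRing B] [Field K] [Field L] [Algebra A K] [IsFractionRing A K] [Algebra A B]
    [Algebra B L] [Algebra K L] [Algebra A L] [IsScalarTower A B L] [IsScalarTower A K L]
    [IsIntegralClosure B A L] [FiniteDimensional K L] [IsGalois K L]
    (p : Ideal A) [p.IsPrime] (hp : p ≠ ⊥) [PerfectField p.ResidueField]
    (P : Ideal B) [P.IsPrime] [P.LiesOver p] (h : p.map (algebraMap A B) ≤ P ^ 2) :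
    ∃ σ : L ≃ₐ[K] L, σ ≠ 1 ∧
      ∀ b : B, ∃ c : B, σ (algebraMap B L b) = algebraMap B L c ∧ c - b ∈ P := by
  have : IsDomain B := (IsIntegralClosure.algebraMap_injective B A L).isDomain
  have := IsIntegralClosure.isDedekindDomain A K L B
  have : Module.Finite A B := IsIntegralClosure.finite A K L B
  have : IsFractionRing B L := IsIntegralClosure.isFractionRing_of_finite_extension A K L B
  have : FaithfulSMul A L := by
    rw [faithfulSMul_iff_algebraMap_injective, IsScalarTower.algebraMap_eq A K L]
    exact (algebraMap K L).injective.comp (IsFractionRing.injective A K)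
  have : FaithfulSMul A B := by
    have := FaithfulSMul.algebraMap_injective A L
    rw [IsScalarTower.algebraMap_eq A B L] at this
    exact (faithfulSMul_iff_algebraMap_injective A B).mpr (Function.Injective.of_comp this)
  let : MulSemiringAction (L ≃ₐ[K] L) B := IsIntegralClosure.MulSemiringAction A K L B
  have : IsGaloisGroup (L ≃ₐ[K] L) A B := IsGaloisGroup.of_isFractionRing _ _ _ K L
  -- The residue field is perfect, so the inertia group has order the ramification index.
  have hcard : Nat.card (P.inertia (L ≃ₐ[K] L)) ≠ 1 := by
    rw [Ideal.card_inertia_eq_ramificationIdxIn p P,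
      Ideal.ramificationIdxIn_eq_ramificationIdx p P (L ≃ₐ[K] L),
      ← Ideal.ramificationIdx'_eq_ramificationIdx p P hp,
      Ideal.ramificationIdx'_ne_one_iff (h.trans (Ideal.pow_le_self two_ne_zero))]
    exact h
  obtain ⟨σ, hσ, hσ1⟩ : ∃ σ ∈ P.inertia (L ≃ₐ[K] L), σ ≠ 1 := by
    by_contra! hall
    exact hcard (Subgroup.card_eq_one.mpr ((Subgroup.eq_bot_iff_forall _).mpr hall))
  refine ⟨σ, hσ1, fun b => ⟨σ • b, ?_, hσ b⟩⟩
  exact (algebraMap.coe_smul' σ b L).symm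

/-- The constants surject onto `F[X]/(X)`, so the residue field is finite. -/
theorem perfectField_residueField_span_X (F : Type*) [Field F] [Finite F]
    [(Ideal.span {(X : F[X])}).IsMaximal] :
    PerfectField (Ideal.span {(X : F[X])}).ResidueField := by
  have h : Function.Surjective ((Ideal.Quotient.mk (Ideal.span {(X : F[X])})).comp C) := by
    intro y
    obtain ⟨q, rfl⟩ := Ideal.Quotient.mk_surjective y
    refine ⟨q.coeff 0, ?_⟩
    rw [RingHom.comp_apply, Ideal.Quotient.eq, Ideal.mem_span_singleton, X_dvd_iff]
    simp
  have := Finite.of_surjective _ h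
  have := Finite.of_surjective _
    (Ideal.bijective_algebraMap_quotient_residueField (Ideal.span {(X : F[X])})).surjective
  infer_instance

end Inertia

/-! ### Multiplicities of the roots of `M` over a residue field -/

section ResidueRoots

variable {F κ ι : Type*} [Field F] [Field κ] [Fintype ι] {M G : F[X]} {φ : F →+* κ} {v : ι → κ}

theorem exists_eq_one_of_map_eq_prod (hfac : M = (X - 1) ^ 2 * G)
    (h : M.map φ = ∏ i, (X - C (v i))) : ∃ i, v i = 1 := by
  have h1 := congrArg (eval 1) h
  rw [hfac, eval_prod] at h1
  simp only [Polynomial.map_mul, Polynomial.map_pow, Polynomial.map_sub, map_X,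
    Polynomial.map_one, eval_mul, eval_pow, eval_sub, eval_X, eval_one, sub_self, eval_C,
    zero_pow two_ne_zero, zero_mul] at h1
  obtain ⟨i, -, hi⟩ := Finset.prod_eq_zero_iff.mp h1.symm
  exact ⟨i, (sub_eq_zero.mp hi).symm⟩

theorem eq_one_of_eq_of_map_eq_prod (hfac : M = (X - 1) ^ 2 * G) (hG : G.Separable)
    (h : M.map φ = ∏ i, (X - C (v i))) {i j : ι} (hij : i ≠ j) (hv : v i = v j) : v i = 1 := by
  classical
  by_contra hne
  -- A repeated root other than `1` would be a double root of the separable `G`.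
  have h1 : (X - C (v i)) ^ 2 ∣ (X - 1) ^ 2 * G.map φ := by
    have h2 := Finset.prod_dvd_prod_of_subset {i, j} Finset.univ (fun i => X - C (v i))
      (Finset.subset_univ _)
    rw [Finset.prod_pair hij, ← hv, ← pow_two, ← h, hfac] at h2
    simpa using h2
  have h2 : IsCoprime ((X - C (v i)) ^ 2) ((X - 1 : κ[X]) ^ 2) := by
    rw [← C_1]
    exact (isCoprime_X_sub_C_of_isUnit_sub (sub_ne_zero.mpr hne).isUnit).pow
  have h3 := h2.dvd_of_dvd_mul_left h1
  rw [pow_two] at h3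
  exact not_isUnit_X_sub_C (v i) ((hG.map (f := φ)).squarefree _ h3)

theorem ne_one_of_map_eq_prod (hfac : M = (X - 1) ^ 2 * G) (hG1 : G.eval 1 ≠ 0)
    (h : M.map φ = ∏ i, (X - C (v i))) {i j k : ι} (hij : i ≠ j) (hik : i ≠ k) (hjk : j ≠ k)
    (hi : v i = 1) (hj : v j = 1) : v k ≠ 1 := by
  classical
  intro hk
  -- Three indices with value `1` would make `1` a root of `G`.
  have h1 : (X - 1) ^ 2 * (X - 1) ∣ (X - 1) ^ 2 * G.map φ := by
    have h2 := Finset.prod_dvd_prod_of_subset {i, j, k} Finset.univ (fun i => X - C (v i))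
      (Finset.subset_univ _)
    rw [Finset.prod_insert (by simp [hij, hik]), Finset.prod_pair hjk, hi, hj, hk, ← h, hfac,
      ← mul_assoc, ← pow_two] at h2
    simpa using h2
  have hX : (X - 1 : κ[X]) ≠ 0 := X_sub_C_ne_zero 1
  have h2 := (mul_dvd_mul_iff_left (pow_ne_zero 2 hX)).mp h1
  rw [← C_1, dvd_iff_isRoot, IsRoot, eval_one_map, map_eq_zero] at h2
  exact hG1 h2

end ResidueRoots

/-! ### Inversion on the roots of `M_t` -/

section Deformed

variable {F E : Type*} [Field F] [Field E] [Algebra (RatFunc F) E] {M : F[X]} {m : ℕ}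

theorem ne_zero_of_mem_rootSet_deformedPoly (hm : 0 < m) (h0 : M.coeff 0 ≠ 0) {α : E}
    (hα : α ∈ (deformedPoly M m).rootSet E) : α ≠ 0 := by
  rintro rfl
  have h := (mem_rootSet.mp hα).2
  rw [deformedPoly] at h
  simp [hm.ne', aeval_def, eval₂_at_zero, h0] at h

/-- The perturbation `t x ^ m` sits in the middle degree of `2 * m`, so it is preserved by reversal
just as `M` is. -/
theorem inv_mem_rootSet_deformedPoly (hm : 0 < m) (h0 : M.coeff 0 ≠ 0)
    (hdeg : M.natDegree = 2 * m) (hrev : M.reverse = M) {α : E}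
    (hα : α ∈ (deformedPoly M m).rootSet E) : α⁻¹ ∈ (deformedPoly M m).rootSet E := by
  have hne := ne_zero_of_mem_rootSet_deformedPoly hm h0 hα
  rw [mem_rootSet] at hα ⊢
  refine ⟨hα.1, ?_⟩
  let : Invertible α := invertibleOfNonzero hne
  have h := hα.2
  have h1 := eval₂_reverse_mul_pow ((algebraMap (RatFunc F) E).comp RatFunc.C) α M
  rw [hrev, hdeg, invOf_eq_inv] at h1
  simp only [deformedPoly, map_add, map_mul, map_pow, aeval_def, eval₂_map, eval₂_C,
    eval₂_X] at h ⊢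
  rw [← h1] at h
  refine (mul_eq_zero.mp (?_ : α ^ (2 * m) * _ = 0)).resolve_left (pow_ne_zero _ hne)
  rw [← h, mul_add, inv_pow]
  have h2 : α ^ (2 * m) * (α ^ m)⁻¹ = α ^ m := by
    rw [two_mul, pow_add, mul_inv_cancel_right₀ (pow_ne_zero m hne)]
  linear_combination (algebraMap (RatFunc F) E RatFunc.X) * h2

theorem ne_inv_of_mem_rootSet_deformedPoly (hM : M.Monic) (hm : 0 < m) (h0 : M.coeff 0 ≠ 0)
    (hdeg : M.natDegree = 2 * m) {α : E} (hα : α ∈ (deformedPoly M m).rootSet E) :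
    α ≠ α⁻¹ := by
  intro h
  have hne := ne_zero_of_mem_rootSet_deformedPoly hm h0 hα
  have hirr := irreducible_deformedPoly hM (m := m) (by omega) h0
  have h1 : α * α = 1 := by
    nth_rewrite 2 [h]
    exact mul_inv_cancel₀ hne
  obtain ⟨c, rfl⟩ : ∃ c, algebraMap (RatFunc F) E c = α := by
    -- `α = ±1` would be a rational root of an irreducible polynomial of degree `2 * m > 1`.
    rcases mul_self_eq_one_iff.mp h1 with rfl | rfl
    · exact ⟨1, map_one _⟩
    · exact ⟨-1, by simp⟩
  have hroot : (deformedPoly M m).IsRoot c := by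
    have := (mem_rootSet.mp hα).2
    rwa [aeval_algebraMap_apply, map_eq_zero] at this
  have h2 : (deformedPoly M m).natDegree = 1 :=
    natDegree_eq_of_degree_eq_some (degree_eq_one_of_irreducible_of_root hirr hroot)
  rw [natDegree_deformedPoly hM (by omega), hdeg] at h2
  omega

theorem map_eq_prod_rootSet {K E : Type*} [Field K] [Field E] [Algebra K E] {f : K[X]}
    (hmon : f.Monic) (hsep : f.Separable) (hspl : (f.map (algebraMap K E)).Splits) :
    f.map (algebraMap K E) = ∏ a : f.rootSet E, (X - C a.1) := by
  classical
  have h1 : ∏ a : f.rootSet E, (X - C a.1) = ∏ a ∈ (f.aroots E).toFinset, (X - C a) :=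
    Finset.prod_coe_sort (f.aroots E).toFinset (fun a => X - C a)
  rw [h1, Finset.prod_eq_multiset_prod, Multiset.toFinset_val,
    (Multiset.dedup_eq_self).mpr (nodup_aroots_iff_of_splits hmon.ne_zero hspl |>.mpr hsep)]
  exact hspl.eq_prod_roots_of_monic (hmon.map _)

end Deformed

/-! ### One transposition from inertia, and transport to all roots -/

section Transposition

variable {F E : Type*} [Field F] [Field E] [Algebra (RatFunc F) E] {M G : F[X]} {m : ℕ}

theorem finiteDimensional_isGalois_of_separable {K E : Type*} [Field K] [Field E] [Algebra K E]
    {f : K[X]} [IsSplittingField K E f] (hsep : f.Separable) :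
    FiniteDimensional K E ∧ IsGalois K E :=
  ⟨IsSplittingField.finiteDimensional E f, IsGalois.of_separable_splitting_field hsep⟩

/-- A nontrivial inertia element at a prime over `t = 0` is a transposition of two mutually inverse
roots. -/
theorem exists_isRootTransposition [Finite F] [IsSplittingField (RatFunc F) E (deformedPoly M m)]
    (hM : M.Monic) (hm : 0 < m) (hdeg : M.natDegree = 2 * m) (h0 : M.coeff 0 ≠ 0)
    (hrev : M.reverse = M) (hG : G.Separable) (hG1 : G.eval 1 ≠ 0) (hfac : M = (X - 1) ^ 2 * G) :
    ∃ α ∈ (deformedPoly M m).rootSet E, ∃ σ : E ≃ₐ[RatFunc F] E,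
      IsRootTransposition (deformedPoly M m) α σ := by
  classical
  set f := deformedPoly M m with hf
  have hsep : f.Separable := separable_deformedPoly hM hm hdeg h0 hG hG1 hfac
  have hPmon := monic_integralDeformedPoly (m := m) hM (by omega)
  have hmon : f.Monic := by
    rw [hf, ← map_integralDeformedPoly]
    exact hPmon.map _
  have hspl : (f.map (algebraMap (RatFunc F) E)).Splits := IsSplittingField.splits E f
  obtain ⟨_, _⟩ := finiteDimensional_isGalois_of_separable (E := E) hsep
  let : Algebra F[X] E :=
    ((algebraMap (RatFunc F) E).comp (algebraMap F[X] (RatFunc F))).toAlgebra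
  have : IsScalarTower F[X] (RatFunc F) E := .of_algebraMap_eq' rfl
  let B := integralClosure F[X] E
  have hBinj : Function.Injective (algebraMap B E) := IsIntegralClosure.algebraMap_injective B F[X] E
  have hmapE : (integralDeformedPoly M m).map (algebraMap F[X] E) =
      f.map (algebraMap (RatFunc F) E) := by
    rw [hf, ← map_integralDeformedPoly, map_map, ← IsScalarTower.algebraMap_eq]
  have hint : ∀ a : f.rootSet E, IsIntegral F[X] a.1 := fun a => by
    refine ⟨_, hPmon, ?_⟩
    rw [← eval_map, hmapE, eval_map, ← aeval_def]
    exact (mem_rootSet.mp a.2).2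
  let b : f.rootSet E → B := fun a => ⟨a.1, hint a⟩
  have hb : ∀ a, algebraMap B E (b a) = a.1 := fun a => rfl
  have hprod : (integralDeformedPoly M m).map (algebraMap F[X] B) =
      ∏ a : f.rootSet E, (X - C (b a)) := by
    apply Polynomial.map_injective _ hBinj
    rw [map_map, ← IsScalarTower.algebraMap_eq, hmapE, map_eq_prod_rootSet hmon hsep hspl,
      Polynomial.map_prod]
    exact Finset.prod_congr rfl fun a _ => by simp [hb]
  -- a prime over `t = 0`
  set p : Ideal F[X] := Ideal.span {X} with hp
  have hpmax : p.IsMaximal :=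
    PrincipalIdealRing.isMaximal_of_irreducible irreducible_X
  have hpbot : p ≠ ⊥ := by
    rw [hp, Ne, Ideal.span_singleton_eq_bot]
    exact X_ne_zero
  have := perfectField_residueField_span_X F
  have hAinj : Function.Injective (algebraMap F[X] B) := by
    refine Function.Injective.of_comp (f := algebraMap B E) ?_
    rw [← RingHom.coe_comp, ← IsScalarTower.algebraMap_eq,
      IsScalarTower.algebraMap_eq F[X] (RatFunc F) E]
    exact (algebraMap (RatFunc F) E).injective.comp (RatFunc.algebraMap_injective F)
  have : FaithfulSMul F[X] B := (faithfulSMul_iff_algebraMap_injective _ _).mpr hAinj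
  obtain ⟨Q, _, _⟩ : Nonempty (p.primesOver B) := inferInstance
  let π : B →+* Q.ResidueField := algebraMap B Q.ResidueField
  have hπ : ∀ x, π x = 0 ↔ x ∈ Q := fun x => Ideal.algebraMap_residueField_eq_zero
  have hXQ : algebraMap F[X] B X ∈ Q := by
    rw [← Ideal.mem_comap]
    change X ∈ Q.under F[X]
    rw [← Q.over_def p]
    exact Ideal.mem_span_singleton_self X
  let φ : F →+* Q.ResidueField := (π.comp (algebraMap F[X] B)).comp C
  have hMprod : M.map φ = ∏ a : f.rootSet E, (X - C (π (b a))) := by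
    have h := congrArg (Polynomial.map π) hprod
    rw [map_map, integralDeformedPoly, Polynomial.map_add, map_map, Polynomial.map_mul, map_C,
      RingHom.comp_apply, (hπ _).mpr hXQ, C_0, zero_mul, add_zero, Polynomial.map_prod] at h
    simpa only [Polynomial.map_sub, map_X, map_C] using h
  have hinv : ∀ a : f.rootSet E, a.1⁻¹ ∈ f.rootSet E := fun a =>
    inv_mem_rootSet_deformedPoly hm h0 hdeg hrev a.2
  have hbinv : ∀ a : f.rootSet E, b a * b ⟨a.1⁻¹, hinv a⟩ = 1 := fun a => by
    apply hBinj
    rw [map_mul, hb, hb, map_one]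
    exact mul_inv_cancel₀ (ne_zero_of_mem_rootSet_deformedPoly hm h0 a.2)
  -- ramification
  have hram : p.map (algebraMap F[X] B) ≤ Q ^ 2 := by
    obtain ⟨a, ha⟩ := exists_eq_one_of_map_eq_prod hfac hMprod
    have haQ : b a - 1 ∈ Q := by
      rw [← hπ, map_sub, map_one, ha, sub_self]
    rw [hp, Ideal.map_span, Set.image_singleton, Ideal.span_singleton_le_iff_mem]
    have h1 : eval (b a) ((integralDeformedPoly M m).map (algebraMap F[X] B)) = 0 := by
      rw [hprod, eval_prod]
      exact Finset.prod_eq_zero (Finset.mem_univ a) (by simp)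
    have h2 : algebraMap F[X] B X * b a ^ m =
        (b a - 1) ^ 2 * -(G.map ((algebraMap F[X] B).comp C)).eval (b a) := by
      rw [integralDeformedPoly, hfac] at h1
      simp only [Polynomial.map_add, Polynomial.map_mul, Polynomial.map_pow, Polynomial.map_sub,
        map_X, Polynomial.map_one, map_C, map_map, eval_add, eval_mul, eval_pow, eval_sub, eval_X,
        eval_one, eval_C] at h1
      linear_combination h1
    -- `b a` is a unit of `B`, its inverse being again a root, so `a ^ m` can be cancelled.
    have h3 : algebraMap F[X] B X =
        algebraMap F[X] B X * b a ^ m * b ⟨a.1⁻¹, hinv a⟩ ^ m := by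
      rw [mul_assoc, ← mul_pow, hbinv, one_pow, mul_one]
    rw [h3, h2]
    exact Ideal.mul_mem_right _ _ (Ideal.mul_mem_right _ _ (Ideal.pow_mem_pow haQ 2))
  obtain ⟨σ, hσ1, hσ⟩ := exists_ne_one_sub_mem_of_map_le_sq (K := RatFunc F) (L := E) p hpbot Q hram
  let s : f.rootSet E → f.rootSet E := fun a => ⟨σ a.1, algEquiv_apply_mem_rootSet σ a.2⟩
  have hs : ∀ a, π (b (s a)) = π (b a) := fun a => by
    obtain ⟨c, hc, hcQ⟩ := hσ (b a)
    have : c = b (s a) := hBinj hc.symm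
    rw [← sub_eq_zero, ← map_sub, hπ, ← this]
    exact hcQ
  have hmoved : ∀ a, s a ≠ a → π (b a) = 1 := fun a ha =>
    eq_one_of_eq_of_map_eq_prod hfac hG hMprod ha.symm (hs a).symm
  obtain ⟨a, ha⟩ : ∃ a, s a ≠ a := by
    by_contra! hall
    exact hσ1 (algEquiv_ext_of_rootSet (f := f) fun x hx => congrArg Subtype.val (hall ⟨x, hx⟩))
  set a' : f.rootSet E := ⟨a.1⁻¹, hinv a⟩ with ha'
  have hne : a.1 ≠ a.1⁻¹ := ne_inv_of_mem_rootSet_deformedPoly hM hm h0 hdeg a.2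
  have hne' : a ≠ a' := fun h => hne (congrArg Subtype.val h)
  have h1 : π (b a) = 1 := hmoved a ha
  have h1' : π (b a') = 1 := by
    have h := congrArg π (hbinv a)
    rwa [map_mul, map_one, h1, one_mul] at h
  have hthree : ∀ c, c ≠ a → c ≠ a' → π (b c) ≠ 1 := fun c hc hc' =>
    ne_one_of_map_eq_prod (v := fun a => π (b a)) hfac hG1 hMprod hne' hc.symm hc'.symm h1 h1'
  -- `s a` has residue `1` like `a`, and only `a` and `a⁻¹` have it.
  have hsa : s a = a' := by
    by_contra h
    exact hthree _ ha h ((hs a).trans h1)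
  have hσa : σ a.1 = a.1⁻¹ := congrArg Subtype.val hsa
  refine ⟨a.1, a.2, σ, hne, hσa, by rw [map_inv₀, hσa, inv_inv], fun β hβ hβ1 hβ2 => ?_⟩
  by_contra h
  exact hthree ⟨β, hβ⟩ (fun h => hβ1 (congrArg Subtype.val h)) (fun h => hβ2 (congrArg Subtype.val h))
    (hmoved _ fun h' => h (congrArg Subtype.val h'))

end Transposition

theorem exists_algEquiv_apply_eq_of_mem_rootSet {K E : Type*} [Field K] [Field E] [Algebra K E]
    [Normal K E] {f : K[X]} (hf : Irreducible f) {α β : E} (hα : α ∈ f.rootSet E)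
    (hβ : β ∈ f.rootSet E) : ∃ ρ : E ≃ₐ[K] E, ρ α = β := by
  have h : minpoly K α = minpoly K β :=
    (minpoly.eq_of_irreducible hf (mem_rootSet.mp hα).2).symm.trans
      (minpoly.eq_of_irreducible hf (mem_rootSet.mp hβ).2)
  obtain ⟨ρ, hρ⟩ := (Normal.minpoly_eq_iff_mem_orbit E).mp h.symm
  exact ⟨ρ, hρ⟩

theorem mainTheorem9 {F : Type*} [Field F] [Finite F] (m r : ℕ) (hr : 1 ≤ r)
    (M : F[X]) (hM : IsSelfReciprocal M) (hdeg : M.natDegree = 2 * m)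
    (g : Fin (r - 1) → F[X]) (hg_monic : ∀ i, (g i).Monic) (hg_irr : ∀ i, Irreducible (g i))
    (hg_inj : Function.Injective g) (hg_one : ∀ i, g i ≠ X - 1) (hg_neg_one : ∀ i, g i ≠ X + 1)
    (hfac : M = (X - 1) ^ 2 * ∏ i, g i)
    (E : Type*) [Field E] [Algebra (RatFunc F) E]
    [Polynomial.IsSplittingField (RatFunc F) E (deformedPoly M m)] :
    (∀ α ∈ (deformedPoly M m).rootSet E,
      ∃ σ : E ≃ₐ[RatFunc F] E, IsRootTransposition (deformedPoly M m) α σ) ∧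
    (blockKernel (deformedPoly M m) E).Normal ∧
    IsElementaryAbelianTwo (blockKernel (deformedPoly M m) E) ∧
    Nat.card (blockKernel (deformedPoly M m) E) = 2 ^ m := by
  have hmonic := hM.1
  have hne_of_root : ∀ (c : F) (i), g i ≠ X - C c → (g i).eval c ≠ 0 := fun c i hi hroot =>
    hi (eq_of_monic_of_associated (hg_monic i) (monic_X_sub_C c)
      (((irreducible_X_sub_C c).associated_of_dvd (hg_irr i) (dvd_iff_isRoot.mpr hroot)).symm))
  have hG1 : (∏ i, g i).eval 1 ≠ 0 := by
    rw [eval_prod, Finset.prod_ne_zero_iff]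
    exact fun i _ => hne_of_root 1 i (by rw [C_1]; exact hg_one i)
  have hGneg : (∏ i, g i).eval (-1) ≠ 0 := by
    rw [eval_prod, Finset.prod_ne_zero_iff]
    exact fun i _ => hne_of_root (-1) i (by rw [C_neg, C_1, sub_neg_eq_add]; exact hg_neg_one i)
  have hG : (∏ i, g i).Separable := by
    refine separable_prod (fun i j hij => ?_) fun i => PerfectField.separable_of_irreducible (hg_irr i)
    refine ((hg_irr i).coprime_iff_not_dvd).mpr fun hdvd => hij (hg_inj ?_)
    exact eq_of_monic_of_associated (hg_monic i) (hg_monic j)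
      ((hg_irr i).associated_of_dvd (hg_irr j) hdvd)
  have hm : 0 < m := by
    have h1 : M.natDegree = 2 + (∏ i, g i).natDegree := by
      have hX : (X - 1 : F[X]) ≠ 0 := X_sub_C_ne_zero 1
      rw [hfac, natDegree_mul (pow_ne_zero _ hX) hG.ne_zero, natDegree_pow, ← C_1,
        natDegree_X_sub_C]
    omega
  have hc : M.coeff 0 = 1 := by
    -- If `2 ≠ 0`, then `-1` is a root neither of `(X - 1) ^ 2` nor of any `g i`.
    refine hM.coeff_zero_eq_one (by simp [hdeg]) (or_iff_not_imp_left.mpr fun h2 => ?_)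
    rw [hfac]
    simp only [eval_mul, eval_pow, eval_sub, eval_X, eval_one]
    refine mul_ne_zero (pow_ne_zero _ fun h => h2 ?_) hGneg
    linear_combination -h
  have h0 : M.coeff 0 ≠ 0 := hc ▸ one_ne_zero
  have hrev := hM.reverse_eq hc
  have hsep := separable_deformedPoly hmonic hm hdeg h0 hG hG1 hfac
  obtain ⟨_, _⟩ := finiteDimensional_isGalois_of_separable (E := E) hsep
  have hirr := irreducible_deformedPoly hmonic (m := m) (by omega) h0
  have htr : ∀ α ∈ (deformedPoly M m).rootSet E,
      ∃ σ : E ≃ₐ[RatFunc F] E, IsRootTransposition (deformedPoly M m) α σ := by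
    intro α hα
    obtain ⟨β, hβ, σ, hσ⟩ :=
      exists_isRootTransposition (E := E) hmonic hm hdeg h0 hrev hG hG1 hfac
    obtain ⟨ρ, rfl⟩ := exists_algEquiv_apply_eq_of_mem_rootSet hirr hβ hα
    exact ⟨_, hσ.conj ρ⟩
  refine ⟨htr, normal_blockKernel, isElementaryAbelianTwo_blockKernel, card_blockKernel ?_
    (fun α hα => inv_mem_rootSet_deformedPoly hm h0 hdeg hrev hα) htr⟩
  rw [← Nat.card_coe_set_eq, Nat.card_eq_fintype_card, card_rootSet_eq_natDegree hsep
    (IsSplittingField.splits E _), natDegree_deformedPoly hmonic (by omega), hdeg]
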